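/- Let $K$ be a field. For a finite connected simple graph $G$ and a subset $C$ of its vertices, let $\delta_C\in\{0,1\}^{E(G)}$ be the vector whose coordinate at an edge $e$ is $1$ if $|C\cap e|=1$ and $0$ otherwise. Let $A_G$ be the integer matrix whose columns are the vectors $(\delta,1)\in\mathbb{Z}^{E(G)}\times\mathbb{Z}$, one for each element $\delta$ of the set $\{\delta_C : C\subseteq V(G)\}$. The cut ideal $I_G$ is the toric ideal of $A_G$ over $K$, that is, the kernel of the $K$-algebra homomorphism from the polynomial ring over $K$ with one variable $x_\delta$ for each column to the ring of Laurent polynomials over $K$ with one indeterminate for each row, which sends $x_\delta$ to the Laurent monomial $\boldsymbol{t}^{(\delta,1)}$. **Proposition.** The cut ideal $I_{K_{2,3}}$ of the complete bipartite graph $K_{2,3}$ is generated by quadratic binomials, that is, by differences of two monomials of degree $2$. However, it has no lexicographic quadratic Gröbner basis: for no linear ordering of the $16$ variables does $I_{K_{2,3}}$ have, with respect to the induced lexicographic order, a Gröbner basis all of whose elements have degree $2$ (in particular, it has none consisting of quadratic binomials). -/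

import Mathlib

namespace CutIdeal

/-! ### Toric ideals -/

section Toric

/-- The toric ideal of an integer matrix `A` with columns indexed by `n`: the kernel of the
`K`-algebra homomorphism from `K[x_j : j ∈ n]` to the Laurent polynomial ring
`K[t_i^{±1} : i ∈ d]` (the group algebra of `ℤ^d`) that sends `x_j` to the Laurent monomial
whose exponent vector is the `j`-th column of `A`. -/
noncomputable def toricIdeal (K : Type*) [Field K] {d n : Type*} (A : Matrix d n ℤ) :
    Ideal (MvPolynomial n K) :=
  RingHom.ker (MvPolynomial.aeval (R := K)
    (fun j : n => (AddMonoidAlgebra.single (A.col j) 1 : AddMonoidAlgebra K (d → ℤ))))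

end Toric

/-! ### Cut ideals of graphs -/

section Cut

variable {V : Type*} [Fintype V] [DecidableEq V]

/-- The cut vector `δ_C ∈ {0,1}^E` of a set `C` of vertices: the coordinate at an edge `e` is `1`
if exactly one end of `e` lies in `C`, and `0` otherwise. -/
def cutVector (G : SimpleGraph V) (C : Finset V) (e : G.edgeSet) : ℤ :=
  if (C ∩ (e : Sym2 V).toFinset).card = 1 then 1 else 0

/-- The configuration `A_G`: its columns are the distinct cut vectors of `G`, each extended by an
additional last entry `1`. -/
def cutMatrix (G : SimpleGraph V) :
    Matrix (G.edgeSet ⊕ Unit) (Set.range (cutVector G)) ℤ :=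
  Matrix.of fun i δ => Sum.elim (δ : G.edgeSet → ℤ) (fun _ => 1) i

/-- The cut ideal of `G`: the toric ideal of `A_G`. Its ambient polynomial ring has one variable
for each cut vector. -/
noncomputable def cutIdeal (K : Type*) [Field K] (G : SimpleGraph V) :
    Ideal (MvPolynomial (Set.range (cutVector G)) K) :=
  toricIdeal K (cutMatrix G)

end Cut

/-! ### Quadratic binomials and Gröbner bases -/

section Groebner

variable {K : Type*} [Field K] {σ : Type*}

/-- A quadratic binomial: a difference of two different monomials of degree two. -/
def IsQuadraticBinomial (p : MvPolynomial σ K) : Prop :=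
  ∃ u v : σ →₀ ℕ, u ≠ v ∧ u.degree = 2 ∧ v.degree = 2 ∧
    p = MvPolynomial.monomial u 1 - MvPolynomial.monomial v 1

/-- The ideal is generated by a set of quadratic binomials. -/
def IsGeneratedByQuadraticBinomials (I : Ideal (MvPolynomial σ K)) : Prop :=
  ∃ S : Set (MvPolynomial σ K), (∀ p ∈ S, IsQuadraticBinomial p) ∧ Ideal.span S = I

/-- The initial ideal of `I`: the ideal generated by the leading terms of the elements of `I`. -/
noncomputable def initialIdeal (m : MonomialOrder σ) (I : Ideal (MvPolynomial σ K)) :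
    Ideal (MvPolynomial σ K) :=
  Ideal.span (m.leadingTerm '' (I : Set (MvPolynomial σ K)))

/-- `B` is a Gröbner basis of `I`: it is contained in `I` and its leading terms generate the
initial ideal of `I`. Finiteness of `B` is not required (in finitely many variables, every such
`B` contains a finite one). -/
def IsGroebnerBasis (m : MonomialOrder σ) (B : Set (MvPolynomial σ K))
    (I : Ideal (MvPolynomial σ K)) : Prop :=
  B ⊆ I ∧ Ideal.span (m.leadingTerm '' B) = initialIdeal m I

/-- `I` has a quadratic Gröbner basis for `m`: one all of whose elements have degree two. Every
Gröbner basis that consists of quadratic binomials is of this kind. -/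
def HasQuadraticGroebnerBasis (m : MonomialOrder σ) (I : Ideal (MvPolynomial σ K)) : Prop :=
  ∃ B : Set (MvPolynomial σ K), IsGroebnerBasis m B I ∧ ∀ g ∈ B, g.totalDegree = 2

/-- `I` has a lexicographic quadratic Gröbner basis: a quadratic one with respect to the
lexicographic order given by some linear order on the variables. -/
def HasLexQuadraticGroebnerBasis [Finite σ] (I : Ideal (MvPolynomial σ K)) : Prop :=
  ∃ _ : LinearOrder σ, HasQuadraticGroebnerBasis (MonomialOrder.lex (σ := σ)) I

end Groebner

end CutIdeal

/-! Complementing a set does not change its cut, so the cuts of $K_{2,3}$ are those of sets avoiding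
the first vertex of the side of size two. They are the points $(x,x)$ and $(x,1-x)$ with
$x\in\{0,1\}^3$: two 3-cubes with a common centre. The quadratic relations used are coordinate
exchanges between two vertices of one cube, and trades of one antipodal pair for another, possibly
in the other cube.

Generation: if $u$ and $v$ lie in one fibre, these moves turn $u$ into a monomial sharing a variable
with $v$ (`exists_linked_common_variable`). Cancelling it gives an induction on degree.

No lexicographic quadratic basis: let $b\bar b$ be the least antipodal pair and $w$ the largest
variable of the cube not containing it. The product of the three neighbours of $w$ lies in the fibre
of $wb\bar b$ and is smaller, so $wb\bar b$ is a leading monomial. But $b\bar b$ is least in its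
fibre, and $wb$, $w\bar b$ are alone in theirs, so $wb\bar b$ is a minimal generator of the initial
ideal, of degree 3 (`not_hasQuadraticGroebnerBasis`). -/

namespace CutIdeal

/-! ### Toric ideals, their fibres, and an obstruction to quadratic Gröbner bases. -/

section ToricGeneral

variable {K : Type*} [Field K] {d n : Type*} {A : Matrix d n ℤ}

/-- The `A`-degree of an exponent vector; its fibres are the fibres of the toric ideal. -/
noncomputable def multidegree (A : Matrix d n ℤ) : (n →₀ ℕ) →ₗ[ℕ] (d → ℤ) :=
  Finsupp.linearCombination ℕ A.col

theorem aeval_col_monomial (u : n →₀ ℕ) (r : K) :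
    MvPolynomial.aeval (R := K)
      (fun j : n => (AddMonoidAlgebra.single (A.col j) 1 : AddMonoidAlgebra K (d → ℤ)))
      (MvPolynomial.monomial u r) = AddMonoidAlgebra.single (multidegree A u) r := by
  induction u using Finsupp.induction_linear generalizing r with
  | zero =>
    rw [map_zero, MvPolynomial.monomial_zero', MvPolynomial.algHom_C]
    simp
  | add u v hu hv =>
    have h : MvPolynomial.monomial (u + v) r
        = MvPolynomial.monomial u r * MvPolynomial.monomial v (1 : K) := by
      rw [MvPolynomial.monomial_mul, mul_one]
    rw [h, map_mul, hu, hv, AddMonoidAlgebra.single_mul_single, mul_one, map_add]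
  | single j k =>
    rw [MvPolynomial.aeval_monomial, Finsupp.prod_single_index (by exact pow_zero _),
      AddMonoidAlgebra.single_pow]
    simp [multidegree]

theorem monomial_sub_monomial_mem_toricIdeal {u v : n →₀ ℕ}
    (h : multidegree A u = multidegree A v) :
    MvPolynomial.monomial u (1 : K) - MvPolynomial.monomial v 1 ∈ toricIdeal K A := by
  rw [toricIdeal, RingHom.mem_ker, map_sub, aeval_col_monomial, aeval_col_monomial, h, sub_self]

/-- A monomial of an element of the toric ideal is never alone in its fibre. -/
theorem exists_mem_support_of_mem_toricIdeal {f : MvPolynomial n K} (hf : f ∈ toricIdeal K A)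
    {u : n →₀ ℕ} (hu : u ∈ f.support) :
    ∃ v ∈ f.support, v ≠ u ∧ multidegree A v = multidegree A u := by
  by_contra! hne
  rw [toricIdeal, RingHom.mem_ker, f.as_sum, map_sum] at hf
  simp only [aeval_col_monomial] at hf
  -- If `u` were alone, its coefficient would survive uncancelled in the image of `f`.
  have h := congrArg (fun g : AddMonoidAlgebra K (d → ℤ) => g.coeff (multidegree A u)) hf
  simp only [AddMonoidAlgebra.coeff_sum, AddMonoidAlgebra.coeff_single, Finsupp.finsetSum_apply,
    AddMonoidAlgebra.coeff_zero, Finsupp.coe_zero, Pi.zero_apply] at h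
  rw [Finset.sum_eq_single_of_mem u hu
    (fun v hv hvu => Finsupp.single_eq_of_ne (hne v hv hvu).symm), Finsupp.single_eq_same] at h
  exact MvPolynomial.mem_support_iff.1 hu h

/-- A toric ideal is generated by its binomials. -/
theorem toricIdeal_le {J : Ideal (MvPolynomial n K)}
    (hJ : ∀ u v, multidegree A u = multidegree A v →
      MvPolynomial.monomial u (1 : K) - MvPolynomial.monomial v 1 ∈ J) :
    toricIdeal K A ≤ J := by
  intro f hf
  -- `s` picks one monomial in each fibre, and `ψ` lifts Laurent polynomials through it. Every `g`
  -- is congruent modulo `J` to the lift of its image, which vanishes for `f`.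
  let s : (d → ℤ) → (n →₀ ℕ) := Function.invFun (multidegree A)
  let ψ : AddMonoidAlgebra K (d → ℤ) →+ MvPolynomial n K :=
    (Finsupp.liftAddHom fun b => (MvPolynomial.monomial (s b) : K →ₗ[K] _).toAddMonoidHom).comp
      (AddMonoidAlgebra.coeffAddEquiv (R := K) (M := d → ℤ)).toAddMonoidHom
  have key : ∀ g : MvPolynomial n K, g - ψ (MvPolynomial.aeval (R := K)
      (fun j : n => (AddMonoidAlgebra.single (A.col j) 1 : AddMonoidAlgebra K (d → ℤ))) g) ∈ J := by
    intro g
    induction g using MvPolynomial.induction_on' with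
    | monomial u r =>
      have hs : multidegree A u = multidegree A (s (multidegree A u)) :=
        (Function.invFun_eq ⟨u, rfl⟩).symm
      have hψ : ψ (AddMonoidAlgebra.single (multidegree A u) r)
          = MvPolynomial.monomial (s (multidegree A u)) r :=
        Finsupp.liftAddHom_apply_single _ _ _
      rw [aeval_col_monomial, hψ]
      simpa [mul_sub, MvPolynomial.C_mul_monomial] using
        J.mul_mem_left (MvPolynomial.C r) (hJ _ _ hs)
    | add p q hp hq =>
      rw [map_add, map_add, add_sub_add_comm]
      exact J.add_mem hp hq
  have := key f
  rw [toricIdeal, RingHom.mem_ker] at hf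
  rwa [hf, map_zero, sub_zero] at this

theorem exists_degree_le_of_monomial_mem_initialIdeal {σ : Type*} {m : MonomialOrder σ}
    {B : Set (MvPolynomial σ K)} {u : σ →₀ ℕ}
    (hu : MvPolynomial.monomial u (1 : K) ∈ Ideal.span (m.leadingTerm '' B)) :
    ∃ g ∈ B, g ≠ 0 ∧ m.degree g ≤ u := by
  rw [m.span_leadingTerm_eq_span_monomial',
    ← Set.image_image (fun i => MvPolynomial.monomial i 1) m.degree,
    MvPolynomial.mem_ideal_span_monomial_image] at hu
  classical
  obtain ⟨_, ⟨g, ⟨hgB, hg0⟩, rfl⟩, hle⟩ := hu u (by simp [MvPolynomial.coeff_monomial])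
  exact ⟨g, hgB, hg0, hle⟩

theorem exists_eq_add_single {σ : Type*} {u : σ →₀ ℕ} {i : σ} (h : u i ≠ 0) :
    ∃ r, u = r + Finsupp.single i 1 := by
  refine ⟨u - Finsupp.single i 1, (tsub_add_cancel_of_le ?_).symm⟩
  rw [Finsupp.single_le_iff]
  exact Nat.one_le_iff_ne_zero.2 h

/-- If a monomial of degree greater than two is not minimal in its fibre, but all its quotients by
variables are minimal in theirs, then there is no quadratic Gröbner basis. -/
theorem not_hasQuadraticGroebnerBasis (m : MonomialOrder n) {u v : n →₀ ℕ} (hu : 2 < u.degree)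
    (huv : multidegree A v = multidegree A u) (hlt : m.toSyn v < m.toSyn u)
    (hmin : ∀ a i, u = a + Finsupp.single i 1 → ∀ b, multidegree A b = multidegree A a →
      ¬ m.toSyn b < m.toSyn a) :
    ¬ HasQuadraticGroebnerBasis m (toricIdeal K A) := by
  rintro ⟨B, ⟨hBI, hB⟩, hdeg⟩
  have hmem : MvPolynomial.monomial u (1 : K) ∈ Ideal.span (m.leadingTerm '' B) := by
    rw [hB]
    refine Ideal.subset_span ⟨_, monomial_sub_monomial_mem_toricIdeal huv.symm, ?_⟩
    have hlt' : m.toSyn (m.degree (MvPolynomial.monomial v (1 : K)))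
        < m.toSyn (m.degree (MvPolynomial.monomial u (1 : K))) := by
      classical
      simpa [MonomialOrder.degree_monomial] using hlt
    rw [MonomialOrder.leadingTerm, m.leadingCoeff_sub_of_lt hlt', m.degree_sub_of_lt hlt']
    classical
    simp [MonomialOrder.degree_monomial]
  obtain ⟨g, hgB, hg0, hgu⟩ := exists_degree_le_of_monomial_mem_initialIdeal hmem
  have hsupp := m.degree_mem_support hg0
  obtain ⟨b, hb, hbne, hbA⟩ := exists_mem_support_of_mem_toricIdeal (hBI hgB) hsupp
  have hblt : m.toSyn b < m.toSyn (m.degree g) :=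
    lt_of_le_of_ne (m.le_degree hb) fun h => hbne (m.toSyn.injective h)
  have hg2 : (m.degree g).degree ≤ 2 := by
    rw [← hdeg g hgB]
    exact MvPolynomial.le_totalDegree hsupp
  obtain ⟨r, rfl⟩ := exists_add_of_le hgu
  have hr : r ≠ 0 := by
    rintro rfl
    rw [add_zero] at hu
    omega
  -- The leading monomial of `g` properly divides `u`, so it divides some quotient of `u` by a
  -- variable. The smaller monomial `b` in its fibre, multiplied up, contradicts minimality of that
  -- quotient.
  obtain ⟨i, hi⟩ := Finsupp.ne_iff.1 hr
  obtain ⟨r', rfl⟩ := exists_eq_add_single hi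
  refine hmin (m.degree g + r') i (add_assoc _ _ _).symm (b + r') ?_ ?_
  · rw [map_add, map_add, hbA]
  · rw [map_add, map_add]
    exact add_lt_add_left hblt _

end ToricGeneral

/-! ### Congruence of monomials modulo the quadratic binomials. -/

section QuadraticPart

variable {K : Type*} [Field K] {d n : Type*} {A : Matrix d n ℤ}

variable (K A) in
/-- The ideal generated by the quadratic binomials of a toric ideal. -/
noncomputable def quadraticPart : Ideal (MvPolynomial n K) :=
  Ideal.span {p | IsQuadraticBinomial p ∧ p ∈ toricIdeal K A}

theorem quadraticPart_le : quadraticPart K A ≤ toricIdeal K A :=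
  Ideal.span_le.2 fun _ hp => hp.2

variable (K A) in
/-- Two exponent vectors are linked if their monomials agree modulo the quadratic binomials. -/
def Linked (u v : n →₀ ℕ) : Prop :=
  MvPolynomial.monomial u (1 : K) - MvPolynomial.monomial v 1 ∈ quadraticPart K A

theorem Linked.refl (u : n →₀ ℕ) : Linked K A u u := by
  rw [Linked, sub_self]
  exact Ideal.zero_mem _

theorem Linked.trans {u v w : n →₀ ℕ} (huv : Linked K A u v) (hvw : Linked K A v w) :
    Linked K A u w := by
  have h := (quadraticPart K A).add_mem huv hvw
  rwa [sub_add_sub_cancel] at h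

theorem Linked.add_right {u v : n →₀ ℕ} (h : Linked K A u v) (r : n →₀ ℕ) :
    Linked K A (u + r) (v + r) := by
  have h' := (quadraticPart K A).mul_mem_right (MvPolynomial.monomial r 1) h
  rwa [sub_mul, MvPolynomial.monomial_mul, MvPolynomial.monomial_mul, mul_one] at h'

theorem Linked.multidegree_eq {u v : n →₀ ℕ} (h : Linked K A u v) :
    multidegree A u = multidegree A v := by
  have h' := quadraticPart_le h
  rw [toricIdeal, RingHom.mem_ker, map_sub, aeval_col_monomial, aeval_col_monomial,
    sub_eq_zero] at h'
  have h'' := congrArg (fun g : AddMonoidAlgebra K (d → ℤ) => g.coeff) h'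
  exact Finsupp.single_left_injective one_ne_zero h''

theorem linked_of_degree_eq_two {u v : n →₀ ℕ} (hu : u.degree = 2) (hv : v.degree = 2)
    (h : multidegree A u = multidegree A v) : Linked K A u v := by
  by_cases huv : u = v
  · exact huv ▸ Linked.refl u
  · exact Ideal.subset_span
      ⟨⟨u, v, huv, hu, hv, rfl⟩, monomial_sub_monomial_mem_toricIdeal h⟩

theorem isGeneratedByQuadraticBinomials_of_linked
    (h : ∀ u v, multidegree A u = multidegree A v → Linked K A u v) :
    IsGeneratedByQuadraticBinomials (toricIdeal K A) :=
  ⟨_, fun _ hp => hp.1, le_antisymm quadraticPart_le (toricIdeal_le h)⟩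

theorem exists_ne_zero_of_degree_ne_zero {σ : Type*} {u : σ →₀ ℕ} (h : u.degree ≠ 0) :
    ∃ i, u i ≠ 0 := by
  by_contra! h0
  exact h (by rw [show u = 0 from Finsupp.ext h0]; exact map_zero _)

theorem eq_single_add_single_of_degree_eq_two {σ : Type*} {u : σ →₀ ℕ} (h : u.degree = 2) :
    ∃ i j, u = Finsupp.single i 1 + Finsupp.single j 1 := by
  obtain ⟨j, hj⟩ := exists_ne_zero_of_degree_ne_zero (u := u) (by omega)
  obtain ⟨r, rfl⟩ := exists_eq_add_single hj
  rw [map_add, Finsupp.degree_single] at h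
  obtain ⟨i, hi⟩ := exists_ne_zero_of_degree_ne_zero (u := r) (by omega)
  obtain ⟨r, rfl⟩ := exists_eq_add_single hi
  rw [map_add, Finsupp.degree_single] at h
  have hr : r = 0 := (Finsupp.degree_eq_zero_iff r).1 (by omega)
  exact ⟨i, j, by rw [hr, zero_add]⟩

end QuadraticPart

/-! ### Quadratic generation for two concentric 3-cubes. -/

section TwoCubes

variable {K : Type*} [Field K] {d n : Type*} {A : Matrix d n ℤ}

/-- The vertices of two 3-cubes. -/
abbrev TwoCubes : Type := Bool × (Fin 3 → Bool)

/-- The opposite vertex of the same cube. -/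
def TwoCubes.antipode (i : TwoCubes) : TwoCubes := (i.1, fun j => !i.2 j)

/-- The number of factors that a monomial has on the facet `x j = β` of the cube `s`. -/
def facetCount (c : TwoCubes ≃ n) (s : Bool) (j : Fin 3) (β : Bool) (u : n →₀ ℕ) : ℕ :=
  ∑ x : Fin 3 → Bool with x j = β, u (c (s, x))

/-- The columns of `A` are the vertices of two 3-cubes in complementary spaces that have the same
centre, in suitable coordinates. -/
def IsTwoCubesMatrix (A : Matrix d n ℤ) (c : TwoCubes ≃ n) : Prop :=
  ∀ u v, multidegree A u = multidegree A v ↔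
    (∀ j, facetCount c false j true u + facetCount c true j true u
      = facetCount c false j true v + facetCount c true j true v) ∧
    (∀ j, facetCount c false j true u + facetCount c true j false u
      = facetCount c false j true v + facetCount c true j false v) ∧
    u.degree = v.degree

variable {c : TwoCubes ≃ n} {s : Bool} {j : Fin 3} {β : Bool}

theorem facetCount_add (u v : n →₀ ℕ) :
    facetCount c s j β (u + v) = facetCount c s j β u + facetCount c s j β v :=
  Finset.sum_add_distrib

theorem facetCount_single (i : TwoCubes) :
    facetCount c s j β (Finsupp.single (c i) 1) = if i.1 = s ∧ i.2 j = β then 1 else 0 := by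
  classical
  obtain ⟨t, y⟩ := i
  simp only [facetCount, Finsupp.single_apply, c.injective.eq_iff, Prod.mk.injEq]
  by_cases hts : t = s
  · simp [hts, Finset.sum_ite_eq]
  · simp [hts]

theorem exists_of_facetCount_ne_zero {u : n →₀ ℕ} (h : facetCount c s j β u ≠ 0) :
    ∃ x : Fin 3 → Bool, x j = β ∧ u (c (s, x)) ≠ 0 := by
  obtain ⟨x, hx, hne⟩ := Finset.exists_ne_zero_of_sum_ne_zero h
  exact ⟨x, (Finset.mem_filter.1 hx).2, hne⟩

theorem facetCount_ne_zero {u : n →₀ ℕ} {x : Fin 3 → Bool} (h : u (c (s, x)) ≠ 0) :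
    facetCount c s j (x j) u ≠ 0 := fun h0 =>
  h (Finset.sum_eq_zero_iff.1 h0 x (by simp))

theorem sum_eq_facetCount_add (u : n →₀ ℕ) :
    ∑ x, u (c (s, x)) = facetCount c s j true u + facetCount c s j false u := by
  rw [facetCount, facetCount, ← Finset.sum_filter_add_sum_filter_not _ (fun x => x j = true)]
  simp

theorem degree_eq_facetCount (c : TwoCubes ≃ n) (j : Fin 3) (u : n →₀ ℕ) :
    u.degree = facetCount c false j true u + facetCount c false j false u
      + (facetCount c true j true u + facetCount c true j false u) := by
  have := Fintype.ofEquiv _ c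
  rw [Finsupp.degree_eq_sum, ← c.sum_comp, Fintype.sum_prod_type, Fintype.sum_bool,
    sum_eq_facetCount_add (j := j), sum_eq_facetCount_add (j := j), add_comm]

theorem IsTwoCubesMatrix.degree_eq (hA : IsTwoCubesMatrix A c) {u v : n →₀ ℕ}
    (h : multidegree A u = multidegree A v) : u.degree = v.degree :=
  ((hA u v).1 h).2.2

theorem IsTwoCubesMatrix.multidegree_eq (hA : IsTwoCubesMatrix A c) {u v : n →₀ ℕ}
    (h : ∀ s j β, facetCount c s j β u = facetCount c s j β v) :
    multidegree A u = multidegree A v := by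
  refine (hA u v).2 ⟨fun j => ?_, fun j => ?_, ?_⟩
  · rw [h, h]
  · rw [h, h]
  · rw [degree_eq_facetCount c 0, degree_eq_facetCount c 0 v, h, h, h, h]

theorem facetCount_swap (x y : Fin 3 → Bool) (t : Bool) (k : Fin 3) :
    facetCount c t k β (Finsupp.single (c (s, Function.update x j (y j))) 1
        + Finsupp.single (c (s, Function.update y j (x j))) 1)
      = facetCount c t k β (Finsupp.single (c (s, x)) 1 + Finsupp.single (c (s, y)) 1) := by
  simp only [facetCount_add, facetCount_single]
  by_cases hk : k = j
  · subst hk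
    simp [add_comm]
  · simp [hk]

theorem linked_swap (hA : IsTwoCubesMatrix A c) (x y : Fin 3 → Bool) :
    Linked K A (Finsupp.single (c (s, x)) 1 + Finsupp.single (c (s, y)) 1)
      (Finsupp.single (c (s, Function.update x j (y j))) 1
        + Finsupp.single (c (s, Function.update y j (x j))) 1) :=
  linked_of_degree_eq_two (by simp) (by simp)
    (hA.multidegree_eq fun _ _ _ => (facetCount_swap x y _ _).symm)

/-- A monomial with factors on the three facets through a vertex is linked to a monomial that is
divisible by the variable of this vertex. -/
theorem exists_linked_of_facetCount_ne_zero (hA : IsTwoCubesMatrix A c) {u : n →₀ ℕ}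
    {x : Fin 3 → Bool} (h : ∀ j, facetCount c s j (x j) u ≠ 0) :
    ∃ v, Linked K A u v ∧ v (c (s, x)) ≠ 0 ∧
      ∀ t j β, facetCount c t j β v = facetCount c t j β u := by
  -- The coordinates of one factor are corrected one at a time; `T` collects those already equal to
  -- those of `x`.
  suffices H : ∀ T : Finset (Fin 3), ∃ v y, Linked K A u v ∧ v (c (s, y)) ≠ 0 ∧
      (∀ j ∈ T, y j = x j) ∧ ∀ t j β, facetCount c t j β v = facetCount c t j β u by
    obtain ⟨v, y, huv, hv, hyx, hc⟩ := H Finset.univ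
    obtain rfl : y = x := funext fun j => hyx j (Finset.mem_univ j)
    exact ⟨v, huv, hv, hc⟩
  intro T
  induction T using Finset.induction_on with
  | empty =>
    obtain ⟨y, -, hy⟩ := exists_of_facetCount_ne_zero (h 0)
    exact ⟨u, y, Linked.refl u, hy, by simp, fun _ _ _ => rfl⟩
  | insert j T hj ih =>
    obtain ⟨v, y, huv, hv, hyx, hc⟩ := ih
    by_cases hyj : y j = x j
    · exact ⟨v, y, huv, hv, Finset.forall_mem_insert _ _ _ |>.2 ⟨hyj, hyx⟩, hc⟩
    -- Exchanges preserve facet counts, so a factor with the right `j`-th coordinate is still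
    -- present, ready to exchange it with `y`.
    obtain ⟨z, hzj, hz⟩ := exists_of_facetCount_ne_zero ((hc s j (x j)).trans_ne (h j))
    obtain ⟨r, rfl⟩ := exists_eq_add_single hv
    have hzy : c (s, y) ≠ c (s, z) := by
      intro he
      rw [c.injective.eq_iff, Prod.mk.injEq] at he
      exact hyj (he.2 ▸ hzj)
    rw [Finsupp.add_apply, Finsupp.single_eq_of_ne hzy.symm, add_zero] at hz
    obtain ⟨r, rfl⟩ := exists_eq_add_single hz
    refine ⟨Finsupp.single (c (s, Function.update y j (z j))) 1
        + Finsupp.single (c (s, Function.update z j (y j))) 1 + r,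
      Function.update y j (z j), ?_, ?_, ?_, ?_⟩
    · refine huv.trans ?_
      have := (linked_swap (K := K) (s := s) (j := j) hA y z).add_right r
      rwa [add_comm (Finsupp.single (c (s, y)) 1), add_comm _ r, ← add_assoc] at this
    · simp
    · intro k hk
      rcases Finset.mem_insert.1 hk with rfl | hkT
      · simp [hzj]
      · rw [Function.update_of_ne (by rintro rfl; exact hj hkT), hyx k hkT]
    · intro t k γ
      rw [← hc, facetCount_add, facetCount_swap]
      simp only [facetCount_add]
      omega

/-- Opposite vertices sum to twice the centre, which both cubes share. -/
theorem multidegree_antipodal_pair (hA : IsTwoCubesMatrix A c) (i k : TwoCubes) :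
    multidegree A (Finsupp.single (c i) 1 + Finsupp.single (c i.antipode) 1)
      = multidegree A (Finsupp.single (c k) 1 + Finsupp.single (c k.antipode) 1) := by
  -- `β = true` and `β = false` are the two rows belonging to one coordinate.
  have key : ∀ β a b p q : Bool,
      ((if a = false ∧ p = true then 1 else 0) + (if a = false ∧ (!p) = true then 1 else 0)
        + ((if a = true ∧ p = β then 1 else 0) + (if a = true ∧ (!p) = β then 1 else 0)))
      = ((if b = false ∧ q = true then 1 else 0) + (if b = false ∧ (!q) = true then 1 else 0)
        + ((if b = true ∧ q = β then 1 else 0) + (if b = true ∧ (!q) = β then 1 else 0)) : ℕ) := by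
    decide
  refine (hA _ _).2 ⟨fun j => ?_, fun j => ?_, by simp⟩ <;>
  · simp only [facetCount_add, facetCount_single, TwoCubes.antipode]
    exact key _ _ _ _ _

theorem exists_linked_common_variable (hA : IsTwoCubesMatrix A c) {u v : n →₀ ℕ}
    (h : multidegree A u = multidegree A v) (hv : v.degree ≠ 0) :
    ∃ u' i, Linked K A u u' ∧ u' i ≠ 0 ∧ v i ≠ 0 := by
  obtain ⟨h1, h2, h3⟩ := (hA u v).1 h
  have hdu := fun j => degree_eq_facetCount c j u
  have hdv := fun j => degree_eq_facetCount c j v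
  by_cases hlt : ∃ s, ∑ x, v (c (s, x)) < ∑ x, u (c (s, x))
  · obtain ⟨s, hs⟩ := hlt
    have hs' : ∀ j, facetCount c s j true v + facetCount c s j false v
        < facetCount c s j true u + facetCount c s j false u := fun j => by
      rwa [← sum_eq_facetCount_add, ← sum_eq_facetCount_add]
    -- The row equations split the excess of `u` over `v` on the cube `s` equally between opposite
    -- facets, so `u` meets every facet.
    have hpos : ∀ j β, facetCount c s j β u ≠ 0 := by
      intro j β
      specialize h1 j; specialize h2 j; specialize hdu j; specialize hdv j; specialize hs' j
      cases s <;> cases β <;> omega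
    obtain ⟨y, hy⟩ : ∃ y : Fin 3 → Bool, v (c (!s, y)) ≠ 0 := by
      have : ∑ x, v (c (!s, x)) ≠ 0 := by
        rw [sum_eq_facetCount_add (j := 0)]
        specialize hdu 0; specialize hdv 0; specialize hs' 0
        cases s <;> simp only [Bool.not_false, Bool.not_true] <;> omega
      obtain ⟨y, -, hy⟩ := Finset.exists_ne_zero_of_sum_ne_zero this
      exact ⟨y, hy⟩
    -- Any antipodal pair of the cube `s` would do; it is then traded for the pair through `y` in
    -- the other cube.
    obtain ⟨u₁, hu₁, hx, hc⟩ := exists_linked_of_facetCount_ne_zero (K := K) hA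
      (x := fun _ => true) (fun j => hpos j _)
    obtain ⟨r, rfl⟩ := exists_eq_add_single hx
    -- The all-`true` vertex lies on none of the facets through its antipode, so removing it leaves
    -- their counts unchanged.
    have hr : ∀ j, facetCount c s j false r ≠ 0 := by
      intro j
      have := hc s j false
      rw [facetCount_add, facetCount_single] at this
      simp only [Bool.true_eq_false, and_false, if_false, add_zero] at this
      exact this.trans_ne (hpos j _)
    obtain ⟨r₁, hr₁, hx', -⟩ := exists_linked_of_facetCount_ne_zero (K := K) hA
      (x := fun _ => false) hr
    obtain ⟨r₂, rfl⟩ := exists_eq_add_single hx'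
    have hpair := (linked_of_degree_eq_two (K := K) (by simp) (by simp)
      (multidegree_antipodal_pair hA (s, fun _ => false) (!s, y))).add_right r₂
    rw [add_comm _ r₂, ← add_assoc] at hpair
    exact ⟨_, c (!s, y), (hu₁.trans (hr₁.add_right _)).trans hpair, by simp, hy⟩
  · push Not at hlt
    obtain ⟨i, hi⟩ := exists_ne_zero_of_degree_ne_zero hv
    obtain ⟨⟨s, x⟩, rfl⟩ := c.surjective i
    -- With equal degrees and no excess, both cubes carry equally many factors of `u` and `v`; the
    -- rows then make all facet counts agree.
    have hpos : ∀ j, facetCount c s j (x j) u ≠ 0 := by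
      intro j
      have hvj := facetCount_ne_zero (j := j) hi
      have hf := hlt false
      have ht := hlt true
      rw [sum_eq_facetCount_add (j := j), sum_eq_facetCount_add (j := j)] at hf ht
      specialize h1 j; specialize h2 j; specialize hdu j; specialize hdv j
      generalize x j = β at *
      cases s <;> cases β <;> omega
    obtain ⟨u', hu', hx, -⟩ := exists_linked_of_facetCount_ne_zero (K := K) hA hpos
    exact ⟨u', _, hu', hx, hi⟩

theorem linked_of_multidegree_eq (hA : IsTwoCubesMatrix A c) :
    ∀ u v, multidegree A u = multidegree A v → Linked K A u v := by
  suffices H : ∀ N : ℕ, ∀ u v : n →₀ ℕ, v.degree = N → multidegree A u = multidegree A v →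
      Linked K A u v from fun u v => H _ u v rfl
  intro N
  induction N with
  | zero =>
    intro u v hv h
    have hu := (hA.degree_eq h).trans hv
    rw [(Finsupp.degree_eq_zero_iff v).1 hv, (Finsupp.degree_eq_zero_iff u).1 hu]
    exact Linked.refl 0
  | succ N ih =>
    intro u v hv h
    obtain ⟨u', i, hu', hui, hvi⟩ :=
      exists_linked_common_variable (K := K) hA h (by omega)
    obtain ⟨a, rfl⟩ := exists_eq_add_single hui
    obtain ⟨b, rfl⟩ := exists_eq_add_single hvi
    rw [map_add, Finsupp.degree_single] at hv
    rw [hu'.multidegree_eq, map_add, map_add] at h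
    exact hu'.trans ((ih a b (by omega) (add_right_cancel h)).add_right _)

end TwoCubes

/-! ### The cubic obstruction for lexicographic orders. -/

section LexOrder

variable {K : Type*} [Field K] {d n : Type*} {A : Matrix d n ℤ} {c : TwoCubes ≃ n}

/-- The comparison starts at the least index, so smaller indices are larger variables. -/
theorem lex_lt_single [LinearOrder n] [WellFoundedGT n] {v : n →₀ ℕ} {i : n}
    (h : ∀ k ≤ i, v k = 0) :
    (MonomialOrder.lex (σ := n)).toSyn v < MonomialOrder.lex.toSyn (Finsupp.single i 1) := by
  rw [MonomialOrder.lex_lt_iff, Finsupp.Lex.lt_iff]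
  refine ⟨i, fun k hk => ?_, ?_⟩
  · exact (h k hk.le).trans (Finsupp.single_eq_of_ne hk.ne).symm
  · change v i < Finsupp.single i 1 i
    simp [h i le_rfl]

/-- The other monomials of degree two in the fibre of a pair of opposite vertices are of the same
kind. -/
theorem eq_antipodal_pair_of_multidegree_eq (hA : IsTwoCubesMatrix A c) {v : n →₀ ℕ}
    {i : TwoCubes} (h : multidegree A v
      = multidegree A (Finsupp.single (c i) 1 + Finsupp.single (c i.antipode) 1)) :
    ∃ k : TwoCubes, v = Finsupp.single (c k) 1 + Finsupp.single (c k.antipode) 1 := by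
  obtain ⟨k, l, rfl⟩ := eq_single_add_single_of_degree_eq_two ((hA.degree_eq h).trans (by simp))
  obtain ⟨k, rfl⟩ := c.surjective k
  obtain ⟨l, rfl⟩ := c.surjective l
  obtain ⟨h1, h2, -⟩ := (hA _ _).1 h
  -- For an antipodal pair both row sums are 1: the first forces `q = !p`, and the second then
  -- forces the same cube.
  have key : ∀ a₁ a₂ a p q r : Bool,
      ((if a₁ = false ∧ p = true then 1 else 0) + (if a₂ = false ∧ q = true then 1 else 0)
        + ((if a₁ = true ∧ p = true then 1 else 0) + (if a₂ = true ∧ q = true then 1 else 0)) : ℕ)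
      = ((if a = false ∧ r = true then 1 else 0) + (if a = false ∧ (!r) = true then 1 else 0)
        + ((if a = true ∧ r = true then 1 else 0) + (if a = true ∧ (!r) = true then 1 else 0))) →
      ((if a₁ = false ∧ p = true then 1 else 0) + (if a₂ = false ∧ q = true then 1 else 0)
        + ((if a₁ = true ∧ p = false then 1 else 0) + (if a₂ = true ∧ q = false then 1 else 0)) : ℕ)
      = ((if a = false ∧ r = true then 1 else 0) + (if a = false ∧ (!r) = true then 1 else 0)
        + ((if a = true ∧ r = false then 1 else 0) + (if a = true ∧ (!r) = false then 1 else 0))) →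
      a₂ = a₁ ∧ q = !p := by decide
  simp only [facetCount_add, facetCount_single, TwoCubes.antipode] at h1 h2
  have hkl : l = k.antipode :=
    Prod.ext (key _ _ _ _ _ _ (h1 0) (h2 0)).1 (funext fun j => (key _ _ _ _ _ _ (h1 j) (h2 j)).2)
  exact ⟨k, by rw [hkl]⟩

/-- A product of two vertices of different cubes is alone in its fibre. -/
theorem eq_of_multidegree_eq_mixed_pair (hA : IsTwoCubesMatrix A c) {v : n →₀ ℕ}
    {i j : TwoCubes} (hij : i.1 = !j.1) (h : multidegree A v
      = multidegree A (Finsupp.single (c i) 1 + Finsupp.single (c j) 1)) :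
    v = Finsupp.single (c i) 1 + Finsupp.single (c j) 1 := by
  obtain ⟨k, l, rfl⟩ := eq_single_add_single_of_degree_eq_two ((hA.degree_eq h).trans (by simp))
  obtain ⟨k, rfl⟩ := c.surjective k
  obtain ⟨l, rfl⟩ := c.surjective l
  obtain ⟨h1, h2, -⟩ := (hA _ _).1 h
  -- The total of the two row sums is odd exactly when the vertices lie in different cubes. The sums
  -- are then $p+q$ and $p+1-q$, with $p$ from the cube `false`, and determine both entries.
  have key : ∀ a₁ a₂ a p q r t : Bool,
      ((if a₁ = false ∧ p = true then 1 else 0) + (if a₂ = false ∧ q = true then 1 else 0)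
        + ((if a₁ = true ∧ p = true then 1 else 0) + (if a₂ = true ∧ q = true then 1 else 0)) : ℕ)
      = ((if (!a) = false ∧ r = true then 1 else 0) + (if a = false ∧ t = true then 1 else 0)
        + ((if (!a) = true ∧ r = true then 1 else 0) + (if a = true ∧ t = true then 1 else 0))) →
      ((if a₁ = false ∧ p = true then 1 else 0) + (if a₂ = false ∧ q = true then 1 else 0)
        + ((if a₁ = true ∧ p = false then 1 else 0) + (if a₂ = true ∧ q = false then 1 else 0)) : ℕ)
      = ((if (!a) = false ∧ r = true then 1 else 0) + (if a = false ∧ t = true then 1 else 0)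
        + ((if (!a) = true ∧ r = false then 1 else 0) + (if a = true ∧ t = false then 1 else 0))) →
      a₂ = (!a₁) ∧ (a₁ = (!a) → p = r ∧ q = t) ∧ (a₁ = a → p = t ∧ q = r) := by decide
  simp only [facetCount_add, facetCount_single, hij] at h1 h2
  have hk := fun m => key _ _ _ _ _ _ _ (h1 m) (h2 m)
  rcases Bool.eq_or_eq_not k.1 j.1 with hkj | hkj
  · have hkj' : k = j := Prod.ext hkj (funext fun m => ((hk m).2.2 hkj).1)
    have hli : l = i := Prod.ext ((hk 0).1.trans (by rw [hkj, hij]))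
      (funext fun m => ((hk m).2.2 hkj).2)
    rw [hkj', hli, add_comm]
  · have hki : k = i := Prod.ext (hkj.trans hij.symm) (funext fun m => ((hk m).2.1 hkj).1)
    have hlj : l = j := Prod.ext ((hk 0).1.trans (by rw [hkj, Bool.not_not]))
      (funext fun m => ((hk m).2.1 hkj).2)
    rw [hki, hlj]

/-- The vertex at the other end of the edge in direction `j`. -/
def TwoCubes.flip (i : TwoCubes) (j : Fin 3) : TwoCubes := (i.1, Function.update i.2 j (!i.2 j))

/-- In each coordinate two neighbours of `w` agree with it and one does not, just as in the product
of `w`, `w` and its antipode; the antipodal pair is then traded. -/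
theorem multidegree_neighbours (hA : IsTwoCubesMatrix A c) (w i : TwoCubes) :
    multidegree A (Finsupp.single (c (w.flip 0)) 1 + Finsupp.single (c (w.flip 1)) 1
        + Finsupp.single (c (w.flip 2)) 1)
      = multidegree A (Finsupp.single (c w) 1
        + (Finsupp.single (c i) 1 + Finsupp.single (c i.antipode) 1)) := by
  rw [map_add (multidegree A) (Finsupp.single (c w) 1), multidegree_antipodal_pair hA i w, ← map_add]
  refine hA.multidegree_eq fun s j β => ?_
  simp only [facetCount_add, facetCount_single, TwoCubes.flip, TwoCubes.antipode]
  fin_cases j <;> simp [Function.update] <;> ring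

theorem TwoCubes.flip_ne (w : TwoCubes) (j : Fin 3) : w.flip j ≠ w := fun h => by
  have := congrFun (congrArg Prod.snd h) j
  simp [TwoCubes.flip] at this

theorem not_hasLexQuadraticGroebnerBasis [Finite n] (hA : IsTwoCubesMatrix A c) :
    ¬ HasLexQuadraticGroebnerBasis (toricIdeal K A) := by
  rintro ⟨_, hB⟩
  obtain ⟨⟨s, b⟩, hb⟩ := Finite.exists_min fun i : TwoCubes =>
    (MonomialOrder.lex (σ := n)).toSyn
      (Finsupp.single (c i) 1 + Finsupp.single (c i.antipode) 1)
  -- The least index is the largest variable of the opposite cube.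
  obtain ⟨w, hw⟩ := Finite.exists_min fun w : Fin 3 → Bool => c (!s, w)
  refine not_hasQuadraticGroebnerBasis MonomialOrder.lex (by simp)
    (multidegree_neighbours hA (!s, w) (s, b)) ?_ ?_ hB
  · refine (lex_lt_single (i := c (!s, w)) fun k hk => ?_).trans_le ?_
    · have hne : ∀ j, k ≠ c (TwoCubes.flip (!s, w) j) := by
        rintro j rfl
        exact TwoCubes.flip_ne _ j (c.injective (le_antisymm hk (hw _)))
      simp [Finsupp.single_eq_of_ne (hne _)]
    · exact MonomialOrder.lex.toSyn_monotone le_self_add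
  · intro a i ha a' ha' hlt
    have hcases : i = c (!s, w) ∨ i = c (s, b) ∨ i = c (TwoCubes.antipode (s, b)) := by
      by_contra! hne
      have := DFunLike.congr_fun ha i
      simp [Finsupp.single_eq_of_ne hne.1, Finsupp.single_eq_of_ne hne.2.1,
        Finsupp.single_eq_of_ne hne.2.2] at this
    rcases hcases with rfl | rfl | rfl
    · rw [add_comm a] at ha
      obtain rfl := add_left_cancel ha
      obtain ⟨k, rfl⟩ := eq_antipodal_pair_of_multidegree_eq hA ha'
      exact (hb k).not_gt hlt
    · rw [add_comm (Finsupp.single (c (s, b)) 1), ← add_assoc] at ha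
      obtain rfl := add_right_cancel ha
      exact hlt.ne (congrArg _ (eq_of_multidegree_eq_mixed_pair hA rfl ha'))
    · rw [← add_assoc] at ha
      obtain rfl := add_right_cancel ha
      exact hlt.ne (congrArg _ (eq_of_multidegree_eq_mixed_pair hA rfl ha'))

end LexOrder

/-! ### The cuts of $K_{2,3}$ as two 3-cubes. -/

section CompleteBipartite

/-- The complete bipartite graph `K_{2,3}`. -/
abbrev graphK23 : SimpleGraph (Fin 2 ⊕ Fin 3) := completeBipartiteGraph (Fin 2) (Fin 3)

/-- The edge of `K_{2,3}` between `a` and `j`. -/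
def edgeK23 (a : Fin 2) (j : Fin 3) : graphK23.edgeSet :=
  ⟨s(Sum.inl a, Sum.inr j), by simp⟩

theorem exists_eq_edgeK23 (e : graphK23.edgeSet) : ∃ a j, e = edgeK23 a j := by
  obtain ⟨e, he⟩ := e
  induction e using Sym2.ind with
  | _ x y =>
    rcases x with a | i <;> rcases y with b | j
    · simp at he
    · exact ⟨a, j, rfl⟩
    · exact ⟨b, i, Subtype.ext Sym2.eq_swap⟩
    · simp at he

theorem cutVector_edgeK23 (C : Finset (Fin 2 ⊕ Fin 3)) (a : Fin 2) (j : Fin 3) :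
    cutVector graphK23 C (edgeK23 a j)
      = if xor (decide (Sum.inl a ∈ C)) (decide (Sum.inr j ∈ C)) then 1 else 0 := by
  have h : (s(Sum.inl a, Sum.inr j) : Sym2 (Fin 2 ⊕ Fin 3)).toFinset = {Sum.inl a, Sum.inr j} := by
    ext x
    simp
  rw [cutVector, edgeK23, h]
  by_cases h1 : (Sum.inl a : Fin 2 ⊕ Fin 3) ∈ C <;> by_cases h2 : (Sum.inr j : Fin 2 ⊕ Fin 3) ∈ C
  · simp [Finset.inter_insert_of_mem, Finset.inter_singleton_of_mem, h1, h2]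
  · simp [Finset.inter_insert_of_mem, Finset.inter_singleton_of_notMem, h1, h2]
  · simp [Finset.inter_insert_of_notMem, Finset.inter_singleton_of_mem, h1, h2]
  · simp [Finset.inter_insert_of_notMem, Finset.inter_singleton_of_notMem, h1, h2]

/-- The set of vertices of `K_{2,3}` that avoids the first vertex of the small side and meets the
rest as prescribed. -/
def cutSide (i : TwoCubes) : Finset (Fin 2 ⊕ Fin 3) :=
  Finset.univ.filter fun v => Sum.elim (fun a => decide (a = 1 ∧ i.1 = true)) i.2 v = true

theorem cutVector_cutSide (i : TwoCubes) (a : Fin 2) (j : Fin 3) :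
    cutVector graphK23 (cutSide i) (edgeK23 a j)
      = if xor (decide (a = 1 ∧ i.1 = true)) (i.2 j) then 1 else 0 := by
  rw [cutVector_edgeK23]
  simp [cutSide]

theorem cutVector_cutSide_injective :
    Function.Injective fun i => cutVector graphK23 (cutSide i) := by
  intro i k h
  have h' := fun a j => congrFun h (edgeK23 a j)
  simp only [cutVector_cutSide] at h'
  have key : ∀ s t p q : Bool,
      ((if xor (decide ((0 : Fin 2) = 1 ∧ s = true)) p then 1 else 0 : ℤ)
        = if xor (decide ((0 : Fin 2) = 1 ∧ t = true)) q then 1 else 0) →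
      ((if xor (decide ((1 : Fin 2) = 1 ∧ s = true)) p then 1 else 0 : ℤ)
        = if xor (decide ((1 : Fin 2) = 1 ∧ t = true)) q then 1 else 0) → s = t ∧ p = q := by
    decide
  exact Prod.ext (key _ _ _ _ (h' 0 0) (h' 1 0)).1
    (funext fun j => (key _ _ _ _ (h' 0 j) (h' 1 j)).2)

theorem exists_cutVector_cutSide_eq (C : Finset (Fin 2 ⊕ Fin 3)) :
    ∃ i, cutVector graphK23 (cutSide i) = cutVector graphK23 C := by
  -- Taking `xor` with the membership of the first vertex replaces `C` by its complement when it
  -- contains that vertex.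
  refine ⟨(xor (decide (Sum.inl 0 ∈ C)) (decide (Sum.inl 1 ∈ C)),
    fun j => xor (decide (Sum.inl 0 ∈ C)) (decide (Sum.inr j ∈ C))), funext fun e => ?_⟩
  obtain ⟨a, j, rfl⟩ := exists_eq_edgeK23 e
  rw [cutVector_cutSide, cutVector_edgeK23]
  congr 2
  fin_cases a
  · simp
  · by_cases h₀ : (Sum.inl 0 : Fin 2 ⊕ Fin 3) ∈ C <;>
      by_cases h₁ : (Sum.inl 1 : Fin 2 ⊕ Fin 3) ∈ C <;>
      by_cases hj : (Sum.inr j : Fin 2 ⊕ Fin 3) ∈ C <;> simp [h₀, h₁, hj]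

/-- The cuts of `K_{2,3}`, indexed by the vertices of two 3-cubes. -/
noncomputable def cutEquiv : TwoCubes ≃ Set.range (cutVector graphK23) :=
  Equiv.ofBijective (fun i => ⟨cutVector graphK23 (cutSide i), Set.mem_range_self _⟩)
    ⟨fun _ _ h => cutVector_cutSide_injective (congrArg Subtype.val h), by
      rintro ⟨_, C, rfl⟩
      obtain ⟨i, hi⟩ := exists_cutVector_cutSide_eq C
      exact ⟨i, Subtype.ext hi⟩⟩

theorem multidegree_apply {d n : Type*} [Fintype n] (A : Matrix d n ℤ) (u : n →₀ ℕ) (r : d) :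
    multidegree A u r = ∑ j, (u j : ℤ) * A r j := by
  rw [multidegree, Finsupp.linearCombination_apply, Finsupp.sum_fintype _ _ (by simp)]
  simp [Finset.sum_apply]

/-- On the cube `true` the second small vertex lies in the set, so its edge to `j` is cut when `j`
does not; hence `decide (a = 0)`. -/
theorem multidegree_cutMatrix_inl (u : Set.range (cutVector graphK23) →₀ ℕ) (a : Fin 2)
    (j : Fin 3) : multidegree (cutMatrix graphK23) u (Sum.inl (edgeK23 a j))
      = (facetCount cutEquiv false j true u + facetCount cutEquiv true j (decide (a = 0)) u : ℕ) := by
  have := Fintype.ofEquiv _ cutEquiv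
  have h : ∀ i, cutMatrix graphK23 (Sum.inl (edgeK23 a j)) (cutEquiv i)
      = if xor (decide (a = 1 ∧ i.1 = true)) (i.2 j) then 1 else 0 := fun i =>
    cutVector_cutSide i a j
  rw [multidegree_apply, ← cutEquiv.sum_comp, Fintype.sum_prod_type, Fintype.sum_bool]
  simp only [h, facetCount, Finset.sum_filter]
  push_cast
  rw [add_comm]
  congr 1
  · simp
  · fin_cases a <;> simp

theorem multidegree_cutMatrix_inr (u : Set.range (cutVector graphK23) →₀ ℕ) :
    multidegree (cutMatrix graphK23) u (Sum.inr ()) = u.degree := by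
  have := Fintype.ofEquiv _ cutEquiv
  rw [multidegree_apply, Finsupp.degree_eq_sum]
  simp [cutMatrix]

theorem isTwoCubesMatrix_cutMatrix : IsTwoCubesMatrix (cutMatrix graphK23) cutEquiv := by
  intro u v
  constructor
  · intro h
    refine ⟨fun j => ?_, fun j => ?_, ?_⟩
    · have := congrFun h (Sum.inl (edgeK23 0 j))
      rw [multidegree_cutMatrix_inl, multidegree_cutMatrix_inl] at this
      exact_mod_cast this
    · have := congrFun h (Sum.inl (edgeK23 1 j))
      rw [multidegree_cutMatrix_inl, multidegree_cutMatrix_inl] at this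
      exact_mod_cast this
    · have := congrFun h (Sum.inr ())
      rw [multidegree_cutMatrix_inr, multidegree_cutMatrix_inr] at this
      exact_mod_cast this
  · rintro ⟨h0, h1, h2⟩
    funext r
    rcases r with e | ⟨⟩
    · obtain ⟨a, j, rfl⟩ := exists_eq_edgeK23 e
      rw [multidegree_cutMatrix_inl, multidegree_cutMatrix_inl]
      fin_cases a
      · exact congrArg _ (h0 j)
      · exact congrArg _ (h1 j)
    · rw [multidegree_cutMatrix_inr, multidegree_cutMatrix_inr, h2]

end CompleteBipartite

end CutIdeal

theorem mainTheorem3 (K : Type*) [Field K] :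
    CutIdeal.IsGeneratedByQuadraticBinomials
        (CutIdeal.cutIdeal K (completeBipartiteGraph (Fin 2) (Fin 3))) ∧
      ¬ CutIdeal.HasLexQuadraticGroebnerBasis
        (CutIdeal.cutIdeal K (completeBipartiteGraph (Fin 2) (Fin 3))) :=
  ⟨CutIdeal.isGeneratedByQuadraticBinomials_of_linked
      (CutIdeal.linked_of_multidegree_eq CutIdeal.isTwoCubesMatrix_cutMatrix),
    CutIdeal.not_hasLexQuadraticGroebnerBasis CutIdeal.isTwoCubesMatrix_cutMatrix⟩
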